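/- Let $T=\mathrm{co}(V)\subset\mathbb{R}^3$ be a tetrahedron with vertex set $V=\{v_0,v_1,v_2,v_3\}$ which is a triangular pyramid with parameter $\eta$, normalised to lateral edge length $1$: $\|v_0-v_i\|^2=1$ for $i=1,2,3$ and $\|v_i-v_j\|^2=\eta$ for $1\le i<j\le 3$ (so $0<\eta<3$). Let $R_T$ be the circumradius of $T$. For $r>0$, an $r$-body is the complement of a nonempty union of open balls of radius $r$, and $co_r(V)$ denotes the smallest $r$-body containing $V$. A point $P$ has distance coordinates $(D_0,D_1,D_2,D_3)_V$ if $\|P-v_i\|^2=D_i$ for all $i$. Put $$g=1024(\eta-3)\rho^3+(-704\eta^2+1920\eta+768)\rho^2+\eta(196\eta^2-732\eta+288)\rho+27\eta^2$$ and consider, in the unknowns $(X,Y,\rho)$, the system $$3(X-Y+1)^2+4\eta X-12X=0,\qquad 3Y^2-4\rho(3Y-\eta)=0,\qquad 4\rho\bigl(4Y-(X-Y-1)^2-\eta X\bigr)-X(4Y-\eta X)=0.\tag{S}$$ A supporting configuration of radius $r$ is a family of spheres $S_0,\dots,S_3$ of radius $r$ such that $v_i\in S_j$ for all $i\ne j$.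 A real solution $(X,Y,\rho)$ of (S), together with a point $O^*$ with distance coordinates $(X,Y,Y,Y)_V$, is geometrically admissible if $X,Y\ge 0$, $\rho>0$, the following Cayley–Menger determinants vanish: that of $(O^*,v_0,\dots,v_3)$ and, for each $k$, the one obtained from it by replacing $v_k$ by a point at squared distance $\rho$ from the other four, and there is a supporting configuration of radius $\sqrt\rho$ all of whose spheres contain $O^*$. An $R^*$-body configuration for $V$ with common point $O^*$ is a supporting configuration $(S_0,\dots,S_3)$ of radius $R^*$ such that, for each $j$, $v_j$ is not in the open ball bounded by $S_j$, $\bigcap_j S_j=\{O^*\}$, and $O^*\in\mathrm{int}(T)$. 1. If $0<\eta<\frac{12}{5}$, then $g$ has a unique real root $\rho$; for this $\rho$ the system (S) has a unique real solution $(X,Y)$, and there is a unique point $O^*$ with distance coordinates $(X,Y,Y,Y)_V$. With $R^*=\sqrt\rho$, $$R^*>R_T,\qquad co_{R^*}(V)=V\cup\{O^*\},\qquad O^*\in\mathrm{int}(T).$$ 2. If $\frac{12}{5}\le\eta<3$, then for every real solution $(X,Y,\rho)$ of (S) there is a unique point $O^*$ with distance coordinates $(X,Y,Y,Y)_V$,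 and with $R^*=\sqrt\rho$: the solution is geometrically admissible, with $X,Y>0$ unless $O^*=v_0$; if $O^*$ is not on the circumsphere of $T$, or $O^*=v_0$, then there is a supporting configuration of radius $R^*$ made of four distinct spheres whose intersection is exactly $\{O^*\}$; but $O^*\notin\mathrm{int}(T)$, and no supporting configuration of radius $R^*$ is an $R^*$-body configuration for $V$ with common point $O^*$. -/

import Mathlib

/-- Euclidean three-dimensional space. -/
abbrev E3 : Type := EuclideanSpace ℝ (Fin 3)

/-- A (nondegenerate) tetrahedron in `ℝ³`, with vertices `T.points 0, …, T.points 3`. -/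
abbrev Tetrahedron : Type := Affine.Simplex ℝ E3 3

/-- The set `V` of vertices of a tetrahedron. -/
def Tetrahedron.vertices (T : Tetrahedron) : Set E3 := Set.range T.points

/-- The interior of the solid tetrahedron `co(V)`. -/
def Tetrahedron.int (T : Tetrahedron) : Set E3 := interior (convexHull ℝ (Set.range T.points))

/-- `T` is a triangular pyramid with parameter `η`, normalised so that the lateral edges have
length one: the apex `v₀` is at squared distance `1` from the three base vertices, and the base
is equilateral with squared edge length `η`. -/
structure IsTriangularPyramid (T : Tetrahedron) (η : ℝ) : Prop where
  lateral : ∀ i, i ≠ 0 → dist (T.points 0) (T.points i) ^ 2 = 1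
  base : ∀ i j, i ≠ 0 → j ≠ 0 → i ≠ j → dist (T.points i) (T.points j) ^ 2 = η

/-- `D` is the vector of distance coordinates (squared distances to the vertices) of `P`. -/
def HasDistCoords (T : Tetrahedron) (D : Fin 4 → ℝ) (P : E3) : Prop :=
  ∀ i, dist P (T.points i) ^ 2 = D i

/-! ### The polynomial systems -/

/-- The cubic `g`, a polynomial in `ρ` with coefficients depending on `η`. -/
def polyG (η ρ : ℝ) : ℝ :=
  1024 * (η - 3) * ρ ^ 3 + (-704 * η ^ 2 + 1920 * η + 768) * ρ ^ 2
    + η * (196 * η ^ 2 - 732 * η + 288) * ρ + 27 * η ^ 2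

/-- The polynomial system for the triangular pyramid with parameters `lam = 1` and `η`, in the
unknowns `(X, Y, ρ)`. -/
def PyramidSystem (η X Y ρ : ℝ) : Prop :=
  3 * (X - Y + 1) ^ 2 + 4 * η * X - 12 * X = 0 ∧
  3 * Y ^ 2 - 4 * ρ * (3 * Y - η) = 0 ∧
  4 * ρ * (4 * Y - (X - Y - 1) ^ 2 - η * X) - X * (4 * Y - η * X) = 0

/-- The Cayley-Menger matrix of a matrix of squared distances: `D` bordered by ones, with a zero
in the corner. -/
def cayleyMenger {n : ℕ} (D : Matrix (Fin n) (Fin n) ℝ) : Matrix (Fin (n + 1)) (Fin (n + 1)) ℝ :=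
  fun a b => Fin.cases (motive := fun _ => ℝ)
    (Fin.cases (motive := fun _ => ℝ) 0 (fun _ => 1) b)
    (fun i => Fin.cases (motive := fun _ => ℝ) 1 (fun j => D i j) b) a

/-- The matrix of squared distances of five points `P, v₀, v₁, v₂, v₃`, where `D` holds the
squared distances of `P` to the vertices of `T`. -/
noncomputable def sqDistMatrix (T : Tetrahedron) (D : Fin 4 → ℝ) : Matrix (Fin 5) (Fin 5) ℝ :=
  fun a b => Fin.cases (motive := fun _ => ℝ)
    (Fin.cases (motive := fun _ => ℝ) 0 (fun j => D j) b)
    (fun i => Fin.cases (motive := fun _ => ℝ) (D i)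
      (fun j => dist (T.points i) (T.points j) ^ 2) b) a

/-- As `sqDistMatrix`, with the vertex `v_k` replaced by a point `w_k` whose squared distance to
all the other four points is `ρ`. -/
noncomputable def sqDistMatrixCentre (T : Tetrahedron) (D : Fin 4 → ℝ) (ρ : ℝ) (k : Fin 4) :
    Matrix (Fin 5) (Fin 5) ℝ :=
  fun a b => if a = b then 0 else if a = k.succ ∨ b = k.succ then ρ else sqDistMatrix T D a b

/-- The Cayley-Menger system of a general tetrahedron, in the unknowns `D = (X, Y, Z, W)`
and `ρ`. -/
def TetrahedronSystem (T : Tetrahedron) (D : Fin 4 → ℝ) (ρ : ℝ) : Prop :=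
  (cayleyMenger (sqDistMatrix T D)).det = 0 ∧
  ∀ k, (cayleyMenger (sqDistMatrixCentre T D ρ k)).det = 0

/-! ### Configurations of spheres -/

/-- The four spheres of radius `R` and centres `c j` support the vertices: the `j`-th sphere
contains the three vertices other than `v_j`. -/
def IsSupportingConfiguration (T : Tetrahedron) (R : ℝ) (c : Fin 4 → E3) : Prop :=
  ∀ j i, i ≠ j → T.points i ∈ Metric.sphere (c j) R

/-- The real solution `(ρ, O)`, with `O` of distance coordinates `D`, of the Cayley-Menger system
is geometrically admissible: there are four supporting spheres of radius `√ρ > 0` which all pass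
through `O`. -/
structure IsGeometricallyAdmissible (T : Tetrahedron) (D : Fin 4 → ℝ) (ρ : ℝ) (O : E3) :
    Prop where
  solution : TetrahedronSystem T D ρ
  coords : HasDistCoords T D O
  nonneg : ∀ i, 0 ≤ D i
  pos : 0 < ρ
  spheres : ∃ c : Fin 4 → E3, IsSupportingConfiguration T (Real.sqrt ρ) c ∧
    ∀ j, O ∈ Metric.sphere (c j) (Real.sqrt ρ)

/-- The four spheres of radius `R` and centres `c j` are an `R`-body configuration for the vertices
of `T`, with common point `O`. -/
structure IsRBodyConfiguration (T : Tetrahedron) (R : ℝ) (O : E3) (c : Fin 4 → E3) : Prop where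
  supporting : IsSupportingConfiguration T R c
  not_mem_ball : ∀ j, T.points j ∉ Metric.ball (c j) R
  inter : (⋂ j, Metric.sphere (c j) R) = {O}
  mem_int : O ∈ T.int

/-! ### `R`-bodies -/

/-- An `R`-body is the complement of a nonempty union of open balls of radius `R`. -/
def IsRBody (R : ℝ) (A : Set E3) : Prop :=
  ∃ C : Set E3, C.Nonempty ∧ A = (⋃ c ∈ C, Metric.ball c R)ᶜ

/-- The `R`-hulloid `co_R(S)`: the intersection of all `R`-bodies containing `S`. -/
def rHulloid (R : ℝ) (S : Set E3) : Set E3 := ⋂₀ {A | IsRBody R A ∧ S ⊆ A}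

/-- As soon as some `R`-body contains `S`, the `R`-hulloid of `S` is the smallest one. -/
theorem isLeast_rHulloid {R : ℝ} {S : Set E3} (h : ∃ A, IsRBody R A ∧ S ⊆ A) :
    IsLeast {A | IsRBody R A ∧ S ⊆ A} (rHulloid R S) := by
  refine ⟨⟨⟨{c | Disjoint S (Metric.ball c R)}, ?_, ?_⟩, fun x hx A hA => hA.2 hx⟩,
    fun A hA => Set.sInter_subset_of_mem hA⟩
  · obtain ⟨A, ⟨C, ⟨c, hc⟩, rfl⟩, hA⟩ := h
    refine ⟨c, Set.disjoint_left.2 fun x hx hxc => hA hx ?_⟩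
    exact Set.mem_biUnion hc hxc
  · ext x
    simp only [Set.mem_compl_iff, Set.mem_iUnion, not_exists]
    constructor
    · intro hx c hc hxc
      have : x ∈ (⋃ d ∈ ({c} : Set E3), Metric.ball d R)ᶜ :=
        hx _ ⟨⟨{c}, Set.singleton_nonempty c, rfl⟩, fun y hy => by
          simpa using fun h' => Set.disjoint_left.1 hc hy (Metric.mem_ball.2 h')⟩
      exact this (Set.mem_biUnion rfl hxc)
    · rintro hx _ ⟨⟨C, -, rfl⟩, hA⟩ hmem
      obtain ⟨c, hc, hxc⟩ := Set.mem_iUnion₂.1 hmem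
      exact hx c (Set.disjoint_left.2 fun y hy hyc => hA hy (Set.mem_biUnion hc hyc)) hxc

/-! Write `k = 1 - η/3`, the squared height of the pyramid, so that `1 - k` is the squared
circumradius of the base. The first equation of (S) puts `O*` on the axis at some relative height
`l` above the base (`pyramidSystem_iff`). The second says that the sphere through the base and `O*`
has squared radius `ρ`. The third says the same of the sphere through a lateral face and `O*`, up to
a factor `X` that vanishes at the apex `l = 1`. Eliminating `ρ` leaves `(l k + 1 - k) * heightCubic
k l = 0`. The linear factor is the antipode of the apex on the circumsphere; there, as at the apex,
`ρ = R_T²`.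

The case distinction is whether `heightCubic` has a root in `(0, 1)`. At `l = 1` its value is `5k -
1`, whence the threshold `k = 1/5`, that is `η = 12/5`. For `k ≤ 1/5` the cubic is negative on `(0,
1)`, so `O*` is never interior. For `k > 1/5` the substitution `s = l k / (1 - k)` makes everything
rational in `s ∈ (1/4, 1)`, and the uniqueness claims become negative discriminants.

The hulloid statement does not need symmetry (`rHulloid_vertices_eq`). Let four spheres of equal
radius `R > R_T` support the vertices and meet in an interior point `O`. A point of `T` other than
`O` and the vertices lies in a simplex with one `v_j` replaced by `O`, hence in the open ball of
`S_j`, which misses the vertices. Conversely, the centre of a ball containing `O` but no vertex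
would lie inside the simplex of the centres `c_j`. Exchanging one `c_j` for the circumcentre then
puts it at distance less than `R` from `v_j`, a contradiction. -/

/-! ### Convex combinations, exchange of vertices, and separation by balls. -/

section ConvexCombinations

variable {E : Type*} [NormedAddCommGroup E] [InnerProductSpace ℝ E] {ι : Type*} [Fintype ι]

/-- The parallel axis identity for a weighted family of points. -/
theorem dist_sq_weightedSum {ω : ι → ℝ} (hω : ∑ i, ω i = 1) (p : ι → E) (a : E) :
    dist (∑ i, ω i • p i) a ^ 2 =
      ∑ i, ω i * dist (p i) a ^ 2 - ∑ i, ω i * dist (p i) (∑ i, ω i • p i) ^ 2 := by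
  set x := ∑ i, ω i • p i with hx
  have h1 : ∀ i, ω i * dist (p i) a ^ 2 - ω i * dist (p i) x ^ 2 =
      ω i * (dist x a ^ 2) + 2 * inner ℝ (ω i • (p i - x)) (x - a) := by
    intro i
    have : p i - a = (p i - x) + (x - a) := by abel
    rw [dist_eq_norm, dist_eq_norm, dist_eq_norm, this, norm_add_sq_real, real_inner_smul_left]
    ring
  rw [← Finset.sum_sub_distrib, Finset.sum_congr rfl fun i _ => h1 i, Finset.sum_add_distrib,
    ← Finset.sum_mul, hω, ← Finset.mul_sum, ← sum_inner]
  have : ∑ i, ω i • (p i - x) = 0 := by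
    simp only [smul_sub, Finset.sum_sub_distrib, ← Finset.sum_smul, hω, ← hx]
    simp
  rw [this, inner_zero_left]
  ring

theorem dist_sq_weightedSum_le {ω : ι → ℝ} (h0 : ∀ i, 0 ≤ ω i) (hω : ∑ i, ω i = 1) (p : ι → E)
    (a : E) : dist (∑ i, ω i • p i) a ^ 2 ≤ ∑ i, ω i * dist (p i) a ^ 2 := by
  rw [dist_sq_weightedSum hω]
  have : 0 ≤ ∑ i, ω i * dist (p i) (∑ i, ω i • p i) ^ 2 :=
    Finset.sum_nonneg fun i _ => mul_nonneg (h0 i) (sq_nonneg _)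
  linarith

/-- A convex combination of points of a sphere which is different from all these points lies in
the open ball. -/
theorem dist_weightedSum_lt {ω : ι → ℝ} (h0 : ∀ i, 0 ≤ ω i) (hω : ∑ i, ω i = 1) {p : ι → E}
    {a : E} {R : ℝ} (hR : 0 ≤ R) (hp : ∀ i, ω i ≠ 0 → dist (p i) a = R)
    (hne : ∀ i, ω i ≠ 0 → ∑ i, ω i • p i ≠ p i) : dist (∑ i, ω i • p i) a < R := by
  refine lt_of_pow_lt_pow_left₀ 2 hR ?_
  rw [dist_sq_weightedSum hω]
  have h1 : ∑ i, ω i * dist (p i) a ^ 2 = R ^ 2 := by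
    rw [← one_mul (R ^ 2), ← hω, Finset.sum_mul]
    refine Finset.sum_congr rfl fun i _ => ?_
    by_cases hi : ω i = 0
    · simp [hi]
    · rw [hp i hi]
  obtain ⟨j, -, hj⟩ : ∃ j ∈ Finset.univ, 0 < ω j :=
    Finset.exists_lt_of_sum_lt (f := fun _ => (0 : ℝ)) (by simp [hω])
  have h2 : 0 < ∑ i, ω i * dist (p i) (∑ i, ω i • p i) ^ 2 :=
    Finset.sum_pos' (fun i _ => mul_nonneg (h0 i) (sq_nonneg _))
      ⟨j, Finset.mem_univ _, mul_pos hj (pow_pos (dist_pos.2 (hne j hj.ne').symm) 2)⟩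
  linarith

/-- In a convex combination one of the points may be exchanged for a given affine combination. -/
theorem exists_exchange [DecidableEq ι] {μ ν : ι → ℝ} (h0 : ∀ i, 0 ≤ μ i) (hμ : ∑ i, μ i = 1)
    (hν : ∑ i, ν i = 1) (p : ι → E) :
    ∃ j, ∃ ω : ι → ℝ, (∀ i, 0 ≤ ω i) ∧ ∑ i, ω i = 1 ∧
      ∑ i, ω i • Function.update p j (∑ i, ν i • p i) i = ∑ i, μ i • p i ∧
      (0 < μ j → 0 < ω j) := by
  obtain ⟨j₀, -, hj₀⟩ : ∃ j ∈ Finset.univ, 0 < ν j :=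
    Finset.exists_lt_of_sum_lt (f := fun _ => (0 : ℝ)) (by simp [hν])
  -- Ratio test as in Carathéodory's theorem: the minimal ratio is the largest multiple of `ν` that
  -- can be subtracted from `μ` keeping all weights nonnegative.
  obtain ⟨j, hj, hmin⟩ := Finset.exists_min_image (Finset.univ.filter fun i => 0 < ν i)
    (fun i => μ i / ν i) ⟨j₀, by simpa using hj₀⟩
  have hνj : 0 < ν j := by simpa using hj
  set κ := μ j / ν j with hκ
  have hκ0 : 0 ≤ κ := div_nonneg (h0 j) hνj.le
  have hnn : ∀ i, 0 ≤ μ i - κ * ν i := by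
    intro i
    rcases lt_or_ge 0 (ν i) with h | h
    · have := hmin i (by simpa using h)
      rw [le_div_iff₀ h] at this
      linarith
    · nlinarith [h0 i]
  have hzero : μ j - κ * ν j = 0 := by rw [hκ]; field_simp; ring
  refine ⟨j, Function.update (fun i => μ i - κ * ν i) j κ, ?_, ?_, ?_, ?_⟩
  · intro i
    by_cases h : i = j
    · subst h; simpa using hκ0
    · simpa [h] using hnn i
  · rw [Finset.sum_update_of_mem (Finset.mem_univ j)]
    have h1 := Finset.sum_sdiff (Finset.subset_univ ({j} : Finset ι))
      (f := fun i => μ i - κ * ν i)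
    rw [Finset.sum_singleton, hzero, add_zero] at h1
    rw [h1, Finset.sum_sub_distrib, ← Finset.mul_sum, hμ, hν]
    ring
  · have h1 : ∀ i, Function.update (fun i => μ i - κ * ν i) j κ i •
        Function.update p j (∑ i, ν i • p i) i =
        Function.update (fun i => (μ i - κ * ν i) • p i) j (κ • ∑ i, ν i • p i) i := by
      intro i
      by_cases h : i = j
      · subst h; simp
      · simp [h]
    rw [Finset.sum_congr rfl fun i _ => h1 i, Finset.sum_update_of_mem (Finset.mem_univ j)]
    have h2 := Finset.sum_sdiff (Finset.subset_univ ({j} : Finset ι))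
      (f := fun i => (μ i - κ * ν i) • p i)
    rw [Finset.sum_singleton, hzero, zero_smul, add_zero] at h2
    rw [h2]
    simp only [sub_smul, mul_smul, Finset.sum_sub_distrib, ← Finset.smul_sum]
    abel
  · intro h
    simpa using div_pos h hνj

/-- A point outside a compact convex set lies in an open ball of any given radius which misses
the set. -/
theorem exists_ball_disjoint_of_notMem {K : Set E} (hK : IsCompact K) (hc : Convex ℝ K)
    (hne : K.Nonempty) {x : E} (hx : x ∉ K) {R : ℝ} (hR : 0 < R) :
    ∃ c, dist x c < R ∧ ∀ a ∈ K, R ≤ dist a c := by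
  obtain ⟨y, hy, hmin⟩ := exists_norm_eq_iInf_of_complete_convex hne hK.isComplete hc x
  have hin := (norm_eq_iInf_iff_real_inner_le_zero hc hy).1 hmin
  have hd : 0 < ‖x - y‖ := norm_pos_iff.2 (sub_ne_zero.2 fun h => hx (h ▸ hy))
  set d := ‖x - y‖ with hd'
  have key : ∀ r : ℝ, 0 ≤ r → ∀ a ∈ K, r * d ≤ dist a (y + r • (x - y)) := by
    intro r hr a ha
    refine (sq_le_sq₀ (by positivity) dist_nonneg).1 ?_
    have h1 : a - (y + r • (x - y)) = (a - y) - r • (x - y) := by abel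
    rw [dist_eq_norm, h1, norm_sub_sq_real, real_inner_smul_right, norm_smul, Real.norm_eq_abs,
      abs_of_nonneg hr, ← hd', real_inner_comm]
    have h2 := hin a ha
    have h3 : r * inner ℝ (x - y) (a - y) ≤ 0 := mul_nonpos_of_nonneg_of_nonpos hr h2
    nlinarith [sq_nonneg ‖a - y‖]
  rcases le_or_gt R d with h | h
  · refine ⟨x, by simpa using hR, fun a ha => ?_⟩
    have := key 1 zero_le_one a ha
    simp only [one_mul, one_smul, add_sub_cancel] at this
    exact h.trans this
  -- The ball of radius `R` on the side of `x` that touches the supporting hyperplane at the nearest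
  -- point `y`.
  · refine ⟨y + (R / d) • (x - y), ?_, fun a ha => ?_⟩
    · have h1 : x - (y + (R / d) • (x - y)) = (1 - R / d) • (x - y) := by
        rw [sub_smul, one_smul]; abel
      rw [dist_eq_norm, h1, norm_smul, Real.norm_eq_abs, ← hd', abs_of_neg]
      · rw [neg_sub, sub_mul, div_mul_cancel₀ _ hd.ne']; linarith
      · rw [sub_neg, lt_div_iff₀ hd]; linarith
    · have := key (R / d) (by positivity) a ha
      rwa [div_mul_cancel₀ _ hd.ne'] at this

end ConvexCombinations

/-! ### Barycentric coordinates, and points determined by distances. -/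

theorem Tetrahedron.affineSpan_eq_top (T : Tetrahedron) :
    affineSpan ℝ (Set.range T.points) = ⊤ := by
  rw [T.independent.affineSpan_eq_top_iff_card_eq_finrank_add_one]
  simp

/-- The vertices of a tetrahedron as an affine basis of space. -/
noncomputable def Tetrahedron.basis (T : Tetrahedron) : AffineBasis (Fin 4) ℝ E3 :=
  ⟨T.points, T.independent, T.affineSpan_eq_top⟩

theorem Tetrahedron.sum_smul_mem_int_iff (T : Tetrahedron) {w : Fin 4 → ℝ} (hw : ∑ i, w i = 1) :
    ∑ i, w i • T.points i ∈ T.int ↔ ∀ i, 0 < w i := by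
  have h1 : T.int = {x | ∀ i, 0 < T.basis.coord i x} := T.basis.interior_convexHull
  have h2 : ∑ i, w i • T.points i = Finset.univ.affineCombination ℝ T.basis w := by
    rw [Finset.affineCombination_eq_linear_combination _ _ _ hw]
    rfl
  rw [h1, h2]
  simp only [Set.mem_ofPred_eq]
  refine forall_congr' fun i => ?_
  rw [T.basis.coord_apply_combination_of_mem (Finset.mem_univ i) hw]

theorem Tetrahedron.exists_sum_smul_eq (T : Tetrahedron) (x : E3) :
    ∃ w : Fin 4 → ℝ, ∑ i, w i = 1 ∧ ∑ i, w i • T.points i = x :=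
  ⟨fun i => T.basis.coord i x, T.basis.sum_coord_apply_eq_one x,
    T.basis.linear_combination_coord_eq_self x⟩

theorem Tetrahedron.eq_zero_of_inner (T : Tetrahedron) {z : E3}
    (h : ∀ i, inner ℝ z (T.points i - T.points 0) = 0) : z = 0 := by
  obtain ⟨w, hw, hx⟩ := T.exists_sum_smul_eq (z + T.points 0)
  have h1 : z = ∑ i, w i • (T.points i - T.points 0) := by
    simp only [smul_sub, Finset.sum_sub_distrib, ← Finset.sum_smul, hw, hx]
    simp
  have h2 : inner ℝ z z = (0 : ℝ) := by
    conv_lhs => rw [h1]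
    rw [← h1, h1, inner_sum]
    refine Finset.sum_eq_zero fun i _ => ?_
    rw [← h1, real_inner_smul_right, h i, mul_zero]
  exact inner_self_eq_zero.1 h2

theorem inner_sub_eq_zero_of_dist_sq_eq {P O a b : E3} (ha : dist P a ^ 2 = dist O a ^ 2)
    (hb : dist P b ^ 2 = dist O b ^ 2) : inner ℝ (P - O) (a - b) = 0 := by
  have e : ∀ a, dist P a ^ 2 = dist O a ^ 2 + ‖P - O‖ ^ 2 + 2 * inner ℝ (P - O) (O - a) := by
    intro a
    have : P - a = (P - O) + (O - a) := by abel
    rw [dist_eq_norm, dist_eq_norm, this, norm_add_sq_real]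
    ring
  have h1 := e a
  have h2 := e b
  have h3 : inner ℝ (P - O) (a - b) = inner ℝ (P - O) (O - b) - inner ℝ (P - O) (O - a) := by
    rw [← inner_sub_right]; congr 1; abel
  rw [h3]; linarith

theorem Tetrahedron.eq_of_dist_sq_eq (T : Tetrahedron) {P O : E3}
    (h : ∀ i, dist P (T.points i) ^ 2 = dist O (T.points i) ^ 2) : P = O :=
  sub_eq_zero.1 (T.eq_zero_of_inner fun i => inner_sub_eq_zero_of_dist_sq_eq (h i) (h 0))

/-- Any five points of space have vanishing Cayley-Menger determinant. -/
theorem det_cayleyMenger_eq_zero (p : Fin 5 → E3) {D : Matrix (Fin 5) (Fin 5) ℝ}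
    (hD : ∀ i j, D i j = dist (p i) (p j) ^ 2) : (cayleyMenger D).det = 0 := by
  have hdep : ¬ AffineIndependent ℝ p := fun h => by
    have := h.card_le_finrank_succ
    have h2 := Submodule.finrank_le (vectorSpan ℝ (Set.range p))
    simp at this h2
    omega
  obtain ⟨w, hw, hwp, j, hj⟩ :
      ∃ w : Fin 5 → ℝ, ∑ i, w i = 0 ∧ ∑ i, w i • p i = 0 ∧ ∃ j, w j ≠ 0 := by
    rw [affineIndependent_iff_of_fintype] at hdep
    push Not at hdep
    obtain ⟨w, hw, hs, j⟩ := hdep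
    refine ⟨w, hw, ?_, j⟩
    rw [Finset.weightedVSub_eq_linear_combination _ hw] at hs
    exact hs
  rw [← Matrix.exists_mulVec_eq_zero_iff]
  -- An affine dependence `w` extends to a kernel vector; the first entry cancels the only part of
  -- `∑ j, D i j * w j` that survives.
  refine ⟨Fin.cons (-∑ i, w i * ‖p i‖ ^ 2) w, fun h => hj (by simpa using congrFun h j.succ), ?_⟩
  funext a
  refine Fin.cases ?_ (fun i => ?_) a
  · simpa [Matrix.mulVec, dotProduct, Fin.sum_univ_succ, cayleyMenger] using hw
  · have h1 : ∀ j, D i j * w j =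
        w j * ‖p i‖ ^ 2 + w j * ‖p j‖ ^ 2 - 2 * inner ℝ (p i) (w j • p j) := by
      intro j
      rw [hD, dist_eq_norm, norm_sub_sq_real, real_inner_smul_right]; ring
    have h2 : ∑ j, D i j * w j = ∑ j, w j * ‖p j‖ ^ 2 := by
      rw [Finset.sum_congr rfl fun j _ => h1 j, Finset.sum_sub_distrib, Finset.sum_add_distrib,
        ← Finset.sum_mul, hw, ← Finset.mul_sum, ← inner_sum, hwp]
      simp
    simp only [Matrix.mulVec, dotProduct]
    rw [Fin.sum_univ_succ]
    simp only [cayleyMenger, Fin.cases_succ, Fin.cases_zero, Fin.cons_zero, Fin.cons_succ]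
    rw [h2]; simp

/-! ### The hulloid of the vertices when four supporting spheres meet inside. -/

section Hulloid

variable {T : Tetrahedron} {R : ℝ} {c : Fin 4 → E3} {O : E3}

/-- Twice this function of `x` is the difference of the powers of `x` with respect to the spheres
of equal radius around `a` and around `O`. -/
noncomputable def powerGap (O a x : E3) : ℝ := ‖a - O‖ ^ 2 / 2 - inner ℝ (a - O) (x - O)

theorem two_mul_powerGap (O a x : E3) : 2 * powerGap O a x = dist a x ^ 2 - dist O x ^ 2 := by
  have h : a - x = (a - O) - (x - O) := by abel
  rw [dist_eq_norm, dist_eq_norm, h, norm_sub_sq_real, norm_sub_rev O x, powerGap]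
  ring

/-- Each gap is affine in `x`, and the linear parts cancel because the weighted vectors from `O` to
the vertices sum to zero. -/
theorem Tetrahedron.sum_mul_powerGap (T : Tetrahedron) {w : Fin 4 → ℝ} (hw : ∑ i, w i = 1)
    (x : E3) :
    ∑ i, w i * powerGap (∑ i, w i • T.points i) (T.points i) x =
      ∑ i, w i * ‖T.points i - ∑ i, w i • T.points i‖ ^ 2 / 2 := by
  set O := ∑ i, w i • T.points i with hO
  have h : ∑ i, w i • (T.points i - O) = 0 := by
    simp only [smul_sub, Finset.sum_sub_distrib, ← Finset.sum_smul, hw, ← hO]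
    simp
  have h2 : ∀ i, w i * powerGap O (T.points i) x = w i * ‖T.points i - O‖ ^ 2 / 2 -
      inner ℝ (w i • (T.points i - O)) (x - O) := by
    intro i
    rw [powerGap, real_inner_smul_left]; ring
  rw [Finset.sum_congr rfl fun i _ => h2 i, Finset.sum_sub_distrib, ← sum_inner, h,
    inner_zero_left, sub_zero]

theorem Tetrahedron.sum_mul_norm_sq_pos (T : Tetrahedron) {w : Fin 4 → ℝ} (hw : ∀ i, 0 < w i)
    (O : E3) : 0 < ∑ i, w i * ‖T.points i - O‖ ^ 2 / 2 := by
  have h01 : T.points 0 ≠ T.points 1 := T.independent.injective.ne (by decide)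
  obtain ⟨i, hi⟩ : ∃ i, T.points i ≠ O := by
    by_contra! h
    exact h01 ((h 0).trans (h 1).symm)
  refine Finset.sum_pos' (fun i _ => ?_) ⟨i, Finset.mem_univ _, ?_⟩
  · have := (hw i).le
    positivity
  · have h1 := norm_pos_iff.2 (sub_ne_zero.2 hi)
    have h2 := hw i
    positivity

theorem IsSupportingConfiguration.powerGap_eq_zero (hc : IsSupportingConfiguration T R c)
    (hO : ∀ j, dist O (c j) = R) {i j : Fin 4} (hij : i ≠ j) :
    powerGap O (T.points i) (c j) = 0 := by
  have h1 := two_mul_powerGap O (T.points i) (c j)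
  rw [hO j, show dist (T.points i) (c j) = R from hc j i hij] at h1
  linarith

/-- At `c j` every gap but the `j`-th vanishes, so the constant weighted sum reduces to one term: up
to scaling, the gaps are barycentric coordinates for the centres. -/
theorem IsSupportingConfiguration.mul_powerGap_eq (hc : IsSupportingConfiguration T R c)
    {w : Fin 4 → ℝ} (hw : ∑ i, w i = 1)
    (hO : ∀ j, dist (∑ i, w i • T.points i) (c j) = R) (j : Fin 4) :
    w j * powerGap (∑ i, w i • T.points i) (T.points j) (c j) =
      ∑ i, w i * ‖T.points i - ∑ i, w i • T.points i‖ ^ 2 / 2 := by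
  have hzero := fun i (hij : i ≠ j) => hc.powerGap_eq_zero hO hij
  rw [← T.sum_mul_powerGap hw (c j)]
  generalize ∑ i, w i • T.points i = O at hzero ⊢
  rw [Finset.sum_eq_single j]
  · intro i _ hij
    rw [hzero i hij, mul_zero]
  · simp

/-- The single surviving gap has the sign of `w j`; this is where interiority of the common point
puts each vertex outside its opposite sphere. -/
theorem IsSupportingConfiguration.lt_dist (hc : IsSupportingConfiguration T R c)
    {w : Fin 4 → ℝ} (hw : ∑ i, w i = 1) (hpos : ∀ i, 0 < w i)
    (hO : ∀ j, dist (∑ i, w i • T.points i) (c j) = R) (j : Fin 4) :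
    R < dist (T.points j) (c j) := by
  have h1 := hc.mul_powerGap_eq hw hO j
  have h2 := T.sum_mul_norm_sq_pos hpos (∑ i, w i • T.points i)
  rw [← h1] at h2
  have h3 := (pos_iff_pos_of_mul_pos h2).1 (hpos j)
  have h4 := two_mul_powerGap (∑ i, w i • T.points i) (T.points j) (c j)
  rw [hO j] at h4
  refine lt_of_pow_lt_pow_left₀ 2 dist_nonneg ?_
  linarith

/-- Points are affine combinations of the centres with coefficients given by the power gaps. -/
theorem IsSupportingConfiguration.sum_smul_center (hc : IsSupportingConfiguration T R c)
    {w : Fin 4 → ℝ} (hw : ∑ i, w i = 1) (hpos : ∀ i, 0 < w i)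
    (hO : ∀ j, dist (∑ i, w i • T.points i) (c j) = R) {M : ℝ}
    (hM : M = ∑ i, w i * ‖T.points i - ∑ i, w i • T.points i‖ ^ 2 / 2) (x : E3) :
    ∑ i, w i * powerGap (∑ i, w i • T.points i) (T.points i) x / M = 1 ∧
      ∑ i, (w i * powerGap (∑ i, w i • T.points i) (T.points i) x / M) • c i = x := by
  have hM0 : 0 < M := hM ▸ T.sum_mul_norm_sq_pos hpos _
  have h1 : ∑ i, w i * powerGap (∑ i, w i • T.points i) (T.points i) x / M = 1 := by
    rw [← Finset.sum_div, T.sum_mul_powerGap hw, ← hM, div_self hM0.ne']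
  refine ⟨h1, ?_⟩
  have hgap := fun j => hc.mul_powerGap_eq hw hO j
  have hzero := fun i j (hij : i ≠ j) => hc.powerGap_eq_zero hO hij
  set O := ∑ i, w i • T.points i with hOdef
  set μ := fun i => w i * powerGap O (T.points i) x / M with hμ
  change ∑ i, μ i • c i = x
  have h1' : ∑ i, μ i = 1 := h1
  -- both sides have the same power gaps
  have key : ∀ i, powerGap O (T.points i) (∑ j, μ j • c j) = powerGap O (T.points i) x := by
    intro i
    have e1 : (∑ j, μ j • c j) - O = ∑ j, μ j • (c j - O) := by
      simp only [smul_sub, Finset.sum_sub_distrib, ← Finset.sum_smul, h1', one_smul]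
    have e2 : powerGap O (T.points i) (∑ j, μ j • c j) =
        ∑ j, μ j * powerGap O (T.points i) (c j) := by
      simp only [powerGap, mul_sub, Finset.sum_sub_distrib, ← Finset.sum_mul, h1', one_mul, e1,
        inner_sum, real_inner_smul_right]
    rw [e2, Finset.sum_eq_single i]
    · have := hgap i
      rw [← hM] at this
      rw [hμ]
      field_simp
      linear_combination powerGap O (T.points i) x * this
    · intro j _ hj
      rw [hzero i j hj.symm, mul_zero]
    · simp
  have h2 : ∀ i, inner ℝ (T.points i - O) ((∑ j, μ j • c j) - x) = (0 : ℝ) := by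
    intro i
    have e : (∑ j, μ j • c j) - x = ((∑ j, μ j • c j) - O) - (x - O) := by abel
    have := key i
    rw [powerGap, powerGap] at this
    rw [e, inner_sub_right]
    linarith
  refine sub_eq_zero.1 (T.eq_zero_of_inner fun i => ?_)
  have e : T.points i - T.points 0 = (T.points i - O) - (T.points 0 - O) := by abel
  rw [e, inner_sub_right, real_inner_comm, h2, real_inner_comm, h2, sub_zero]

/-- If the four vertices are not in the open ball around `x`, then neither is the common point of
the supporting spheres. -/
theorem IsSupportingConfiguration.le_dist_of_forall_le (hc : IsSupportingConfiguration T R c)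
    {w : Fin 4 → ℝ} (hw : ∑ i, w i = 1) (hpos : ∀ i, 0 < w i)
    (hO : ∀ j, dist (∑ i, w i • T.points i) (c j) = R) {Q : E3}
    (hQ : ∀ i, dist Q (T.points i) < R) {x : E3} (hx : ∀ i, R ≤ dist (T.points i) x) :
    R ≤ dist (∑ i, w i • T.points i) x := by
  by_contra! hlt
  have hR : 0 < R := dist_nonneg.trans_lt (hQ 0)
  set M := ∑ i, w i * ‖T.points i - ∑ i, w i • T.points i‖ ^ 2 / 2 with hM
  have hM0 : 0 < M := T.sum_mul_norm_sq_pos hpos _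
  obtain ⟨hμ, hμx⟩ := hc.sum_smul_center hw hpos hO hM x
  obtain ⟨hν, hνQ⟩ := hc.sum_smul_center hw hpos hO hM Q
  have hμpos : ∀ i, 0 < w i * powerGap (∑ i, w i • T.points i) (T.points i) x / M := by
    intro i
    refine div_pos (mul_pos (hpos i) ?_) hM0
    have h1 := two_mul_powerGap (∑ i, w i • T.points i) (T.points i) x
    have h2 := pow_lt_pow_left₀ (hlt.trans_le (hx i)) dist_nonneg two_ne_zero
    linarith
  -- `x` is now a convex combination of `Q` and the centres other than `c j`, with positive weight
  -- on `Q`; all these points are within `R` of `v_j`, and `Q` strictly.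
  obtain ⟨j, ω, hω0, hω1, hsum, hωj⟩ := exists_exchange (fun i => (hμpos i).le) hμ hν c
  rw [hμx, hνQ] at hsum
  have h1 := dist_sq_weightedSum_le hω0 hω1 (Function.update c j Q) (T.points j)
  rw [hsum] at h1
  have h2 : ∑ i, ω i * dist (Function.update c j Q i) (T.points j) ^ 2 < ∑ i, ω i * R ^ 2 := by
    refine Finset.sum_lt_sum (fun i _ => mul_le_mul_of_nonneg_left ?_ (hω0 i))
      ⟨j, Finset.mem_univ _, mul_lt_mul_of_pos_left ?_ (hωj (hμpos j))⟩
    · by_cases hij : i = j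
      · subst hij
        simpa using (pow_lt_pow_left₀ (hQ i) dist_nonneg two_ne_zero).le
      · rw [Function.update_of_ne hij, dist_comm,
          show dist (T.points j) (c i) = R from hc i j (Ne.symm hij)]
    · simpa using pow_lt_pow_left₀ (hQ j) dist_nonneg two_ne_zero
  rw [← Finset.sum_mul, hω1, one_mul] at h2
  have h3 := pow_le_pow_left₀ hR.le (hx j) 2
  rw [dist_comm x] at h1
  linarith

/-- If four supporting spheres of radius larger than the circumradius meet in an interior point,
then this point is all that the hulloid of the vertices contains besides the vertices. -/
theorem IsSupportingConfiguration.rHulloid_vertices_eq (hc : IsSupportingConfiguration T R c)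
    (hO : ∀ j, dist O (c j) = R) (hint : O ∈ T.int) {Q : E3}
    (hQ : ∀ i, dist Q (T.points i) < R) : rHulloid R T.vertices = T.vertices ∪ {O} := by
  have hR : 0 < R := dist_nonneg.trans_lt (hQ 0)
  obtain ⟨w, hw, rfl⟩ := T.exists_sum_smul_eq O
  have hpos := (T.sum_smul_mem_int_iff hw).1 hint
  refine Set.Subset.antisymm (fun x hx => ?_) ?_
  · by_contra hxn
    simp only [Set.mem_union, Set.mem_singleton_iff, not_or] at hxn
    obtain ⟨hxV, hxO⟩ := hxn
    suffices h : ∃ d, dist x d < R ∧ ∀ i, R ≤ dist (T.points i) d by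
      obtain ⟨d, hd, hV⟩ := h
      have : x ∈ (⋃ e ∈ ({d} : Set E3), Metric.ball e R)ᶜ := by
        refine hx _ ⟨⟨{d}, Set.singleton_nonempty d, rfl⟩, ?_⟩
        rintro _ ⟨i, rfl⟩
        simpa using hV i
      simp only [Set.mem_singleton_iff, Set.iUnion_iUnion_eq_left, Set.mem_compl_iff,
        Metric.mem_ball] at this
      exact this hd
    by_cases hxT : x ∈ convexHull ℝ (Set.range T.points)
    · obtain ⟨μ, hμ0, hμ1, hμx⟩ : ∃ μ : Fin 4 → ℝ, (∀ i, 0 ≤ μ i) ∧ ∑ i, μ i = 1 ∧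
          ∑ i, μ i • T.points i = x := by
        rw [convexHull_range_eq_exists_affineCombination] at hxT
        obtain ⟨s, μ, h0, h1, h2⟩ := hxT
        rw [Finset.affineCombination_eq_linear_combination _ _ _ h1] at h2
        refine ⟨fun i => if i ∈ s then μ i else 0, fun i => ?_, ?_, ?_⟩
        · dsimp only; split_ifs with h
          · exact h0 i h
          · exact le_rfl
        · simpa [Finset.sum_ite_mem] using h1
        · simpa [ite_smul, Finset.sum_ite_mem] using h2
      -- With `v_j` replaced by the common point, all four points lie on the `j`-th sphere.
      obtain ⟨j, ω, hω0, hω1, hsum, -⟩ := exists_exchange hμ0 hμ1 hw T.points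
      rw [hμx] at hsum
      refine ⟨c j, ?_, fun i => ?_⟩
      · rw [← hsum]
        refine dist_weightedSum_lt hω0 hω1 hR.le (fun i _ => ?_) fun i _ => ?_
        · by_cases hij : i = j
          · subst hij; simpa using hO i
          · rw [Function.update_of_ne hij]; exact hc j i hij
        · rw [hsum]
          by_cases hij : i = j
          · subst hij; simpa using hxO
          · rw [Function.update_of_ne hij]
            exact fun h => hxV ⟨i, h.symm⟩
      · by_cases hij : i = j
        · subst hij; exact (hc.lt_dist hw hpos hO i).le
        · exact (show dist (T.points i) (c j) = R from hc j i hij).ge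
    · obtain ⟨d, hd, hK⟩ := exists_ball_disjoint_of_notMem
        ((Set.finite_range T.points).isCompact_convexHull ℝ) (convex_convexHull ℝ _)
        ((Set.range_nonempty _).convexHull) hxT hR
      exact ⟨d, hd, fun i => hK _ (subset_convexHull ℝ _ ⟨i, rfl⟩)⟩
  · rintro x hx _ ⟨⟨C, -, rfl⟩, hA⟩
    rcases hx with hx | rfl
    · exact hA hx
    · simp only [Set.mem_compl_iff, Set.mem_iUnion, Metric.mem_ball, not_exists, not_lt]
      intro d hd
      refine hc.le_dist_of_forall_le hw hpos hO hQ fun i => ?_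
      have := hA ⟨i, rfl⟩
      simp only [Set.mem_compl_iff, Set.mem_iUnion, Metric.mem_ball, not_exists, not_lt] at this
      exact this d hd

end Hulloid

/-- Four spheres supporting the vertices and passing through a common point yield a solution of
the Cayley-Menger system. -/
theorem tetrahedronSystem_of_spheres {T : Tetrahedron} {D : Fin 4 → ℝ} {ρ : ℝ} {O : E3}
    {c : Fin 4 → E3} (hρ : 0 ≤ ρ) (hO : HasDistCoords T D O)
    (hc : IsSupportingConfiguration T (Real.sqrt ρ) c)
    (hOc : ∀ j, O ∈ Metric.sphere (c j) (Real.sqrt ρ)) : TetrahedronSystem T D ρ := by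
  have h1 : ∀ i j, sqDistMatrix T D i j =
      dist ((Fin.cons O T.points : Fin 5 → E3) i) ((Fin.cons O T.points : Fin 5 → E3) j) ^ 2 := by
    intro i j
    refine Fin.cases ?_ (fun i => ?_) i <;> refine Fin.cases ?_ (fun j => ?_) j
    · simp [sqDistMatrix]
    · simpa [sqDistMatrix] using (hO j).symm
    · simpa [sqDistMatrix, dist_comm] using (hO i).symm
    · simp [sqDistMatrix]
  refine ⟨det_cayleyMenger_eq_zero _ h1, fun k => ?_⟩
  have h2 : ∀ i : Fin 5, i ≠ k.succ →
      dist ((Fin.cons O T.points : Fin 5 → E3) i) (c k) ^ 2 = ρ := by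
    intro i
    refine Fin.cases (fun _ => ?_) (fun i hi => ?_) i
    · rw [Fin.cons_zero, show dist O (c k) = Real.sqrt ρ from hOc k, Real.sq_sqrt hρ]
    · rw [Fin.cons_succ, show dist (T.points i) (c k) = Real.sqrt ρ from
        hc k i fun h => hi (h ▸ rfl), Real.sq_sqrt hρ]
  refine det_cayleyMenger_eq_zero
    (Function.update (Fin.cons O T.points : Fin 5 → E3) k.succ (c k)) fun a b => ?_
  unfold sqDistMatrixCentre
  split_ifs with hab h
  · simp [hab]
  · rcases h with rfl | rfl
    · rw [Function.update_self, Function.update_of_ne (Ne.symm hab), dist_comm,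
        h2 _ (Ne.symm hab)]
    · rw [Function.update_self, Function.update_of_ne hab, h2 _ hab]
  · rw [not_or] at h
    rw [Function.update_of_ne h.1, Function.update_of_ne h.2, h1]

/-! ### Affine coordinates along the lateral edges, and the metric of a pyramid. -/

/-- The point with coordinates `x, y, z` in the affine frame formed by the lateral edges. -/
noncomputable def Tetrahedron.pt (T : Tetrahedron) (x y z : ℝ) : E3 :=
  ∑ i, ![1 - x - y - z, x, y, z] i • T.points i

theorem sum_frame_weights (x y z : ℝ) : ∑ i, ![1 - x - y - z, x, y, z] i = 1 := by
  simp [Fin.sum_univ_four]; ring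

namespace Tetrahedron

variable (T : Tetrahedron)

theorem pt_zero : T.pt 0 0 0 = T.points 0 := by simp [pt, Fin.sum_univ_four]
theorem pt_one : T.pt 1 0 0 = T.points 1 := by simp [pt, Fin.sum_univ_four]
theorem pt_two : T.pt 0 1 0 = T.points 2 := by simp [pt, Fin.sum_univ_four]
theorem pt_three : T.pt 0 0 1 = T.points 3 := by simp [pt, Fin.sum_univ_four]

theorem pt_eq (x y z : ℝ) : T.pt x y z = T.points 0 + (x • (T.points 1 - T.points 0) +
    y • (T.points 2 - T.points 0) + z • (T.points 3 - T.points 0)) := by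
  simp only [pt, Fin.sum_univ_four, Matrix.cons_val]
  module

theorem pt_inj {x y z x' y' z' : ℝ} (h : T.pt x y z = T.pt x' y' z') :
    x = x' ∧ y = y' ∧ z = z' := by
  have e : ∀ (x y z : ℝ) (i : Fin 4), T.basis.coord i (T.pt x y z) =
      ![1 - x - y - z, x, y, z] i := by
    intro x y z i
    have : T.pt x y z = Finset.univ.affineCombination ℝ T.basis ![1 - x - y - z, x, y, z] := by
      rw [Finset.affineCombination_eq_linear_combination _ _ _ (sum_frame_weights x y z)]
      rfl
    rw [this, T.basis.coord_apply_combination_of_mem (Finset.mem_univ i) (sum_frame_weights x y z)]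
  have h' : ∀ i, ![1 - x - y - z, x, y, z] i = ![1 - x' - y' - z', x', y', z'] i := by
    intro i; rw [← e, ← e, h]
  exact ⟨h' 1, h' 2, h' 3⟩

theorem pt_diag_mem_int_iff (a : ℝ) : T.pt a a a ∈ T.int ↔ 0 < a ∧ 0 < 1 - 3 * a := by
  rw [pt, T.sum_smul_mem_int_iff (sum_frame_weights a a a)]
  simp only [Fin.forall_fin_succ, Matrix.cons_val]
  constructor
  · intro h
    have h0 := h.1
    have h1 := h.2.1
    simp at h0 h1
    exact ⟨h1, by linarith⟩
  · rintro ⟨h1, h2⟩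
    simp [h1]
    linarith

end Tetrahedron

section Pyramid

variable {T : Tetrahedron} {k : ℝ}

theorem dist_sq_pt (hT : IsTriangularPyramid T (3 * (1 - k))) (x y z x' y' z' : ℝ) :
    dist (T.pt x y z) (T.pt x' y' z') ^ 2 = (x - x') ^ 2 + (y - y') ^ 2 + (z - z') ^ 2 +
      (3 * k - 1) * ((x - x') * (y - y') + (x - x') * (z - z') + (y - y') * (z - z')) := by
  have hn : ∀ i, i ≠ 0 → ‖T.points i - T.points 0‖ ^ 2 = 1 := fun i hi => by
    rw [← dist_eq_norm, dist_comm]; exact hT.lateral i hi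
  have hi : ∀ i j, i ≠ 0 → j ≠ 0 → i ≠ j →
      inner ℝ (T.points i - T.points 0) (T.points j - T.points 0) = (3 * k - 1) / 2 := by
    intro i j h1 h2 h3
    have h4 := hT.base i j h1 h2 h3
    have h5 : T.points i - T.points j =
        (T.points i - T.points 0) - (T.points j - T.points 0) := by abel
    rw [dist_eq_norm, h5, norm_sub_sq_real, hn i h1, hn j h2] at h4
    linarith
  have e : T.pt x y z - T.pt x' y' z' = (x - x') • (T.points 1 - T.points 0) +
      (y - y') • (T.points 2 - T.points 0) + (z - z') • (T.points 3 - T.points 0) := by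
    rw [T.pt_eq, T.pt_eq]; module
  rw [dist_eq_norm, e, norm_add_sq_real, norm_add_sq_real, inner_add_left]
  simp only [real_inner_smul_left, real_inner_smul_right, norm_smul, mul_pow, Real.norm_eq_abs,
    sq_abs]
  rw [hn 1 (by decide), hn 2 (by decide), hn 3 (by decide), hi 1 2 (by decide) (by decide)
    (by decide), hi 1 3 (by decide) (by decide) (by decide), hi 2 3 (by decide) (by decide)
    (by decide)]
  ring

/-- Four centres placed symmetrically with respect to the axis of a pyramid. -/
noncomputable def axialCenters (T : Tetrahedron) (β γ δ : ℝ) : Fin 4 → E3 :=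
  ![T.pt β β β, T.pt (γ + δ) γ γ, T.pt γ (γ + δ) γ, T.pt γ γ (γ + δ)]

theorem axialCenters_injective {β γ δ : ℝ} (hδ : δ ≠ 0) :
    Function.Injective (axialCenters T β γ δ) := by
  intro i j h
  fin_cases i <;> fin_cases j <;> first | rfl | (
    exfalso
    obtain ⟨h1, h2, h3⟩ := T.pt_inj h
    apply hδ
    linarith)

/-- Equal distances make `P - O` orthogonal to all differences of centres. In the edge frame these
have determinant `δ ^ 2 * (3 * γ + δ - 3 * β)`, so they span space. -/
theorem eq_of_dist_axialCenters_eq {β γ δ : ℝ} (hδ : δ ≠ 0) (hτ : 3 * γ + δ - 3 * β ≠ 0)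
    {P O : E3} (h : ∀ j, dist P (axialCenters T β γ δ j) ^ 2 =
      dist O (axialCenters T β γ δ j) ^ 2) : P = O := by
  have h' := fun j => inner_sub_eq_zero_of_dist_sq_eq (h j) (h 0)
  refine sub_eq_zero.1 (T.eq_zero_of_inner fun i => ?_)
  set q := fun i => inner ℝ (P - O) (T.points i - T.points 0) with hq
  have e1 : T.pt (γ + δ) γ γ - T.pt β β β = (γ + δ - β) • (T.points 1 - T.points 0) +
      (γ - β) • (T.points 2 - T.points 0) + (γ - β) • (T.points 3 - T.points 0) := by
    rw [T.pt_eq, T.pt_eq]; module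
  have e2 : T.pt γ (γ + δ) γ - T.pt β β β = (γ - β) • (T.points 1 - T.points 0) +
      (γ + δ - β) • (T.points 2 - T.points 0) + (γ - β) • (T.points 3 - T.points 0) := by
    rw [T.pt_eq, T.pt_eq]; module
  have e3 : T.pt γ γ (γ + δ) - T.pt β β β = (γ - β) • (T.points 1 - T.points 0) +
      (γ - β) • (T.points 2 - T.points 0) + (γ + δ - β) • (T.points 3 - T.points 0) := by
    rw [T.pt_eq, T.pt_eq]; module
  have q1 : (γ + δ - β) * q 1 + (γ - β) * q 2 + (γ - β) * q 3 = 0 := by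
    have := h' 1
    change inner ℝ (P - O) (T.pt (γ + δ) γ γ - T.pt β β β) = 0 at this
    rwa [e1, inner_add_right, inner_add_right, real_inner_smul_right, real_inner_smul_right,
      real_inner_smul_right] at this
  have q2 : (γ - β) * q 1 + (γ + δ - β) * q 2 + (γ - β) * q 3 = 0 := by
    have := h' 2
    change inner ℝ (P - O) (T.pt γ (γ + δ) γ - T.pt β β β) = 0 at this
    rwa [e2, inner_add_right, inner_add_right, real_inner_smul_right, real_inner_smul_right,
      real_inner_smul_right] at this
  have q3 : (γ - β) * q 1 + (γ - β) * q 2 + (γ + δ - β) * q 3 = 0 := by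
    have := h' 3
    change inner ℝ (P - O) (T.pt γ γ (γ + δ) - T.pt β β β) = 0 at this
    rwa [e3, inner_add_right, inner_add_right, real_inner_smul_right, real_inner_smul_right,
      real_inner_smul_right] at this
  have hs : q 1 + q 2 + q 3 = 0 :=
    (mul_eq_zero.1 (show (3 * γ + δ - 3 * β) * (q 1 + q 2 + q 3) = 0 by
      linear_combination q1 + q2 + q3)).resolve_left hτ
  have hz : ∀ j : Fin 4, δ * q j = 0 → q j = 0 := fun j hj => (mul_eq_zero.1 hj).resolve_left hδ
  change q i = 0
  fin_cases i
  · simp [hq]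
  · exact hz 1 (by linear_combination q1 - (γ - β) * hs)
  · exact hz 2 (by linear_combination q2 - (γ - β) * hs)
  · exact hz 3 (by linear_combination q3 - (γ - β) * hs)

theorem dist_eq_sqrt_of_sq_eq {a b : E3} {ρ : ℝ} (h : dist a b ^ 2 = ρ) : dist a b = √ρ := by
  rw [← h, Real.sqrt_sq dist_nonneg]

theorem isSupportingConfiguration_axialCenters (hT : IsTriangularPyramid T (3 * (1 - k)))
    {β γ δ ρ : ℝ}
    (h0 : 3 * β ^ 2 - 2 * β + 1 + (3 * k - 1) * (3 * β ^ 2 - 2 * β) = ρ)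
    (h1 : (γ + δ) ^ 2 + 2 * γ ^ 2 + (3 * k - 1) * (2 * (γ + δ) * γ + γ ^ 2) = ρ)
    (h2 : (γ + δ) ^ 2 + γ ^ 2 + (γ - 1) ^ 2 +
      (3 * k - 1) * ((γ + δ) * γ + (γ + δ) * (γ - 1) + γ * (γ - 1)) = ρ) :
    IsSupportingConfiguration T √ρ (axialCenters T β γ δ) := by
  intro j i hij
  refine dist_eq_sqrt_of_sq_eq ?_
  fin_cases j <;> fin_cases i <;> first | exact absurd rfl hij | skip
  all_goals
    simp only [axialCenters, Fin.zero_eta, Fin.mk_one, Fin.reduceFinMk, Matrix.cons_val]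
    simp only [← T.pt_zero, ← T.pt_one, ← T.pt_two, ← T.pt_three, dist_sq_pt hT]
    first | linear_combination h0 | linear_combination h1 | linear_combination h2

theorem dist_axialCenters (hT : IsTriangularPyramid T (3 * (1 - k))) {α β γ δ ρ : ℝ}
    (h0 : 9 * k * (β - α) ^ 2 = ρ)
    (h1 : (γ + δ - α) ^ 2 + 2 * (γ - α) ^ 2 +
      (3 * k - 1) * (2 * (γ + δ - α) * (γ - α) + (γ - α) ^ 2) = ρ) (j : Fin 4) :
    dist (T.pt α α α) (axialCenters T β γ δ j) = √ρ := by
  refine dist_eq_sqrt_of_sq_eq ?_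
  fin_cases j
  all_goals
    simp only [axialCenters, Fin.zero_eta, Fin.mk_one, Fin.reduceFinMk, Matrix.cons_val]
    simp only [dist_sq_pt hT]
    first | linear_combination h0 | linear_combination h1

theorem hasDistCoords_iff (hT : IsTriangularPyramid T (3 * (1 - k))) (l : ℝ) (P : E3) :
    HasDistCoords T ![k * (1 - l) ^ 2, l ^ 2 * k + (1 - k), l ^ 2 * k + (1 - k),
      l ^ 2 * k + (1 - k)] P ↔ P = T.pt ((1 - l) / 3) ((1 - l) / 3) ((1 - l) / 3) := by
  have h : HasDistCoords T ![k * (1 - l) ^ 2, l ^ 2 * k + (1 - k), l ^ 2 * k + (1 - k),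
      l ^ 2 * k + (1 - k)] (T.pt ((1 - l) / 3) ((1 - l) / 3) ((1 - l) / 3)) := by
    intro i
    fin_cases i
    all_goals
      simp only [Fin.zero_eta, Fin.mk_one, Fin.reduceFinMk, Matrix.cons_val]
      simp only [← T.pt_zero, ← T.pt_one, ← T.pt_two, ← T.pt_three, dist_sq_pt hT]
      ring
  refine ⟨fun hP => T.eq_of_dist_sq_eq fun i => (hP i).trans (h i).symm, ?_⟩
  rintro rfl
  exact h

theorem circumcenter_eq_and_circumradius_sq (hT : IsTriangularPyramid T (3 * (1 - k)))
    (hk : k ≠ 0) : T.circumcenter = T.pt (1 / (6 * k)) (1 / (6 * k)) (1 / (6 * k)) ∧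
      T.circumradius ^ 2 = 1 / (4 * k) := by
  have h : ∀ i, dist (T.points i) (T.pt (1 / (6 * k)) (1 / (6 * k)) (1 / (6 * k))) =
      √(1 / (4 * k)) := by
    intro i
    refine dist_eq_sqrt_of_sq_eq ?_
    fin_cases i
    all_goals
      simp only [Fin.zero_eta, Fin.mk_one, Fin.reduceFinMk]
      simp only [← T.pt_zero, ← T.pt_one, ← T.pt_two, ← T.pt_three, dist_sq_pt hT]
      field_simp
      ring
  have hmem : T.pt (1 / (6 * k)) (1 / (6 * k)) (1 / (6 * k)) ∈
      affineSpan ℝ (Set.range T.points) := by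
    rw [T.affineSpan_eq_top]; trivial
  have hc := T.eq_circumcenter_of_dist_eq hmem h
  refine ⟨hc.symm, ?_⟩
  rw [← T.dist_circumcenter_eq_circumradius 0, ← hc, ← T.pt_zero, dist_sq_pt hT]
  field_simp
  ring

end Pyramid

/-! ### Solutions of the pyramid system -/

/-- The cubic for the relative height `l` of the common point above the base. -/
def heightCubic (k l : ℝ) : ℝ :=
  4 * k ^ 2 * l ^ 3 + 2 * (1 - k) * k * l ^ 2 + (1 - k) * k * l - (1 - k) ^ 2

/-- The real solutions of the pyramid system, parametrised by the relative height of the common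
point above the base. -/
theorem pyramidSystem_iff {k : ℝ} (hk : 0 < k) (X Y ρ : ℝ) :
    PyramidSystem (3 * (1 - k)) X Y ρ ↔ ∃ l, X = k * (1 - l) ^ 2 ∧ Y = l ^ 2 * k + (1 - k) ∧
      Y ^ 2 = 4 * ρ * l ^ 2 * k ∧ (l = 1 ∨ 4 * ρ * (1 - k) = 4 * Y - 3 * (1 - k) * X) := by
  constructor
  · rintro ⟨h1, h2, h3⟩
    obtain ⟨l, hl⟩ : ∃ l, X - Y + 1 = 2 * k * (1 - l) :=
      ⟨1 - (X - Y + 1) / (2 * k), by field_simp; ring⟩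
    have hX : X = k * (1 - l) ^ 2 := by
      rw [hl] at h1
      have : k * (X - k * (1 - l) ^ 2) = 0 := by linear_combination -h1 / 12
      linarith [(mul_eq_zero.1 this).resolve_left hk.ne']
    have hY : Y = l ^ 2 * k + (1 - k) := by linear_combination hX - hl
    refine ⟨l, hX, hY, by rw [hY] at h2 ⊢; linear_combination h2 / 3, ?_⟩
    -- `X` factors out of the third equation, which therefore says nothing at the apex.
    by_cases h : l = 1
    · exact Or.inl h
    right
    have : X * (4 * ρ * (1 - k) - (4 * Y - 3 * (1 - k) * X)) = 0 := by
      rw [hX, hY] at h3 ⊢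
      linear_combination h3
    have hX0 : X ≠ 0 := by
      rw [hX]; exact mul_ne_zero hk.ne' (pow_ne_zero 2 (sub_ne_zero.2 (Ne.symm h)))
    linarith [(mul_eq_zero.1 this).resolve_left hX0]
  · rintro ⟨l, hX, hY, h2, h3⟩
    refine ⟨by rw [hX, hY]; ring, by rw [hY] at h2 ⊢; linear_combination 3 * h2, ?_⟩
    have : X * (4 * ρ * (1 - k) - (4 * Y - 3 * (1 - k) * X)) = 0 := by
      rcases h3 with rfl | h3
      · rw [hX]; ring
      · rw [h3]; ring
    rw [hX, hY] at this ⊢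
    linear_combination this

theorem heightCubic_of_generic {k l ρ : ℝ} (h1 : (l ^ 2 * k + (1 - k)) ^ 2 = 4 * ρ * l ^ 2 * k)
    (h2 : 4 * ρ * (1 - k) = 4 * (l ^ 2 * k + (1 - k)) - 3 * (1 - k) * (k * (1 - l) ^ 2)) :
    l * k + (1 - k) = 0 ∨ heightCubic k l = 0 := by
  rw [← mul_eq_zero, heightCubic]
  linear_combination -(1 - k) * h1 - l ^ 2 * k * h2

theorem height_ne_zero {k l ρ : ℝ} (hk1 : k < 1)
    (h1 : (l ^ 2 * k + (1 - k)) ^ 2 = 4 * ρ * l ^ 2 * k) : l ≠ 0 := by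
  rintro rfl
  nlinarith

/-- The apex and its antipode lie on the circumsphere, so the sphere through the base and such a
point is the circumsphere itself. -/
theorem radius_sq_of_antipodal {k l ρ : ℝ} (hk : 0 < k) (hk1 : k < 1)
    (h1 : (l ^ 2 * k + (1 - k)) ^ 2 = 4 * ρ * l ^ 2 * k) (h : l = 1 ∨ l * k + (1 - k) = 0) :
    ρ = 1 / (4 * k) := by
  rcases h with rfl | h
  · field_simp
    linear_combination -h1
  · have e1 : (l ^ 2 * k + (1 - k)) * k = 1 - k := by
      linear_combination (l * k - (1 - k)) * h
    have e2 : (l * k) ^ 2 = (1 - k) ^ 2 := by linear_combination (l * k - (1 - k)) * h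
    have hz : (1 - k) ^ 2 * (4 * k * ρ - 1) = 0 := by
      linear_combination -k ^ 2 * h1 - 4 * ρ * k * e2 +
        ((l ^ 2 * k + (1 - k)) * k + (1 - k)) * e1
    have := (mul_eq_zero.1 hz).resolve_left (pow_ne_zero 2 (by linarith))
    field_simp
    linarith

/-- The centres of the supporting spheres through the axial point of relative height `l`. -/
noncomputable def heightCenters (T : Tetrahedron) (k l : ℝ) : Fin 4 → E3 :=
  axialCenters T ((1 - (l ^ 2 * k - (1 - k)) / (2 * l * k)) / 3)
    ((1 - l) / 6 + (1 + l * k / (1 - k)) / 3) (-(1 + l * k / (1 - k)))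

section

variable {T : Tetrahedron} {k l ρ : ℝ}

/-- The first centre is the axial point equidistant from `O` and the base. Each other one is level
with the midpoint of `v₀` and `O`, displaced horizontally by `δ` times the vector from the base
centroid to `v_j`; equidistance from `v₀` and the other base vertices forces `δ = -(1 + l k / (1 -
k))`. -/
theorem heightCenters_spec (hT : IsTriangularPyramid T (3 * (1 - k))) (hk : 0 < k) (hk1 : k < 1)
    (h1 : (l ^ 2 * k + (1 - k)) ^ 2 = 4 * ρ * l ^ 2 * k)
    (h2 : 4 * ρ * (1 - k) = 4 * (l ^ 2 * k + (1 - k)) - 3 * (1 - k) * (k * (1 - l) ^ 2)) :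
    IsSupportingConfiguration T √ρ (heightCenters T k l) ∧
      ∀ j, dist (T.pt ((1 - l) / 3) ((1 - l) / 3) ((1 - l) / 3)) (heightCenters T k l j) =
        √ρ := by
  have hl := height_ne_zero hk1 h1
  have hb : 1 - k ≠ 0 := by linarith
  have e1 : ρ = (l ^ 2 * k + (1 - k)) ^ 2 / (4 * l ^ 2 * k) := by
    field_simp; linear_combination -h1
  have e2 : ρ = (4 * (l ^ 2 * k + (1 - k)) - 3 * (1 - k) * (k * (1 - l) ^ 2)) / (4 * (1 - k)) := by
    field_simp; linear_combination h2
  constructor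
  · refine isSupportingConfiguration_axialCenters hT ?_ ?_ ?_
    · rw [e1]; field_simp; ring
    · rw [e2]; field_simp; ring
    · rw [e2]; field_simp; ring
  · refine dist_axialCenters hT ?_ ?_
    · rw [e1]; field_simp; ring
    · rw [e2]; field_simp; ring

theorem iInter_sphere_axialCenters {β γ δ : ℝ} {O : E3} (hδ : δ ≠ 0)
    (hτ : 3 * γ + δ - 3 * β ≠ 0) (hO : ∀ j, dist O (axialCenters T β γ δ j) = √ρ) :
    (⋂ j, Metric.sphere (axialCenters T β γ δ j) √ρ) = {O} := by
  ext P
  simp only [Set.mem_iInter, Metric.mem_sphere, Set.mem_singleton_iff]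
  constructor
  · intro h
    exact eq_of_dist_axialCenters_eq hδ hτ fun j => by rw [h, hO]
  · rintro rfl
    exact hO

/-- For a common point off the circumsphere the spheres are distinct and meet only there. -/
theorem heightCenters_inter (hk : 0 < k) (hk1 : k < 1) (hl : l ≠ 0) (ha : l * k + (1 - k) ≠ 0)
    {O : E3} (hO : ∀ j, dist O (heightCenters T k l j) = √ρ) :
    Function.Injective (heightCenters T k l) ∧
      (⋂ j, Metric.sphere (heightCenters T k l j) √ρ) = {O} := by
  have hb : 1 - k ≠ 0 := by linarith
  have hδ : -(1 + l * k / (1 - k)) ≠ 0 := by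
    rw [neg_ne_zero]
    intro h
    field_simp at h
    apply ha; linarith
  refine ⟨axialCenters_injective hδ, iInter_sphere_axialCenters hδ ?_ hO⟩
  have e : 3 * ((1 - l) / 6 + (1 + l * k / (1 - k)) / 3) + -(1 + l * k / (1 - k)) -
      3 * ((1 - (l ^ 2 * k - (1 - k)) / (2 * l * k)) / 3) = -(l * k + (1 - k)) / (2 * l * k) := by
    field_simp
    ring
  rw [e]
  exact div_ne_zero (neg_ne_zero.2 ha) (by positivity)

/-- At the apex the circumsphere and its reflections in the lateral faces meet only there. -/
theorem exists_supporting_at_apex (hT : IsTriangularPyramid T (3 * (1 - k))) (hk : 0 < k)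
    (hk1 : k < 1) : ∃ c : Fin 4 → E3, IsSupportingConfiguration T √(1 / (4 * k)) c ∧
      Function.Injective c ∧ (∀ j, dist (T.points 0) (c j) = √(1 / (4 * k))) ∧
      (⋂ j, Metric.sphere (c j) √(1 / (4 * k))) = {T.points 0} := by
  have hb : 1 - k ≠ 0 := by linarith
  have h3 : 1 + 3 * k ≠ 0 := by linarith
  -- On the line of points equidistant from the vertices of a lateral face, parametrised by `e`, the
  -- squared distance to them is `1 / (4 * k)` for `e = 0`, the circumcentre, and for this `e`, its
  -- reflection.
  set e := 2 / (1 + 3 * k) with he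
  set c := axialCenters T (1 / (6 * k)) (((1 - (1 - k) * e) / (2 * k) + e) / 3) (-e) with hc
  have hdist : ∀ j, dist (T.points 0) (c j) = √(1 / (4 * k)) := by
    rw [← T.pt_zero]
    refine dist_axialCenters hT ?_ ?_
    · field_simp; ring
    · rw [he]; field_simp; ring
  have hδ : -e ≠ 0 := neg_ne_zero.2 (div_ne_zero two_ne_zero h3)
  refine ⟨c, isSupportingConfiguration_axialCenters hT ?_ ?_ ?_, axialCenters_injective hδ, hdist,
    iInter_sphere_axialCenters hδ ?_ hdist⟩
  · field_simp; ring
  · rw [he]; field_simp; ring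
  · rw [he]; field_simp; ring
  · intro h
    rw [he] at h
    field_simp at h
    apply hb; linarith

end

/-! ### The range in which the common point is interior -/

/-- The rational parametrisation of the pyramids whose common point is interior. -/
theorem exists_parameter {b : ℝ} (hb : 0 < b) (hb1 : b < 4 / 5) :
    ∃ s, 1 / 4 < s ∧ s < 1 ∧ b * (4 * s ^ 3 + 2 * s ^ 2 - s + 1) = 1 - s := by
  -- The value at `s = 1/4` is `3/4 - 15 b / 16`, positive exactly when `b < 4/5`; at `s = 1` it is
  -- `-6 b`.
  have hcont : ContinuousOn
      (fun s : ℝ => 1 - s - b * (4 * s ^ 3 + 2 * s ^ 2 - s + 1)) (Set.Icc (1 / 4) 1) := by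
    fun_prop
  obtain ⟨s, hs, h⟩ := intermediate_value_Ioo' (by norm_num) hcont
    (show (0 : ℝ) ∈ Set.Ioo _ _ from ⟨by norm_num; linarith, by norm_num; linarith⟩)
  exact ⟨s, hs.1, hs.2, by linarith [show (_ : ℝ) = 0 from h]⟩

/-- Dividing the difference of the two equations by `s' - s` and eliminating `b` leaves a quadratic
in `s'`, whose discriminant is negative for `s > 1/4`. -/
theorem parameter_unique {b s s' : ℝ} (hs : 1 / 4 < s) (hs1 : s < 1)
    (h : b * (4 * s ^ 3 + 2 * s ^ 2 - s + 1) = 1 - s)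
    (h' : b * (4 * s' ^ 3 + 2 * s' ^ 2 - s' + 1) = 1 - s') : s' = s := by
  by_contra hne
  have h1 : (s' - s) * (b * (4 * (s ^ 2 + s * s' + s' ^ 2) + 2 * (s + s') - 1) + 1) = 0 := by
    linear_combination h' - h
  have h2 := (mul_eq_zero.1 h1).resolve_left (sub_ne_zero.2 hne)
  have h3 : (1 - s) * (4 * (s ^ 2 + s * s' + s' ^ 2) + 2 * (s + s') - 1) +
      (4 * s ^ 3 + 2 * s ^ 2 - s + 1) = 0 := by
    linear_combination (4 * s ^ 3 + 2 * s ^ 2 - s + 1) * h2 -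
      (4 * (s ^ 2 + s * s' + s' ^ 2) + 2 * (s + s') - 1) * h
  have h4 : (1 - s) * (4 * s' + 2 * s + 1) ^ 2 =
      -4 * s ^ 3 - 16 * s ^ 2 - 5 * s + 1 := by
    linear_combination 4 * h3
  have h5 : 0 ≤ (1 - s) * (4 * s' + 2 * s + 1) ^ 2 := mul_nonneg (by linarith) (sq_nonneg _)
  nlinarith [pow_pos (show 0 < s by linarith) 3, mul_pos (show 0 < s by linarith) (sub_pos.2 hs)]

/-- In terms of `s`, the cubic splits into a linear factor and a quadratic. The sign of the
discriminant of the latter is that of `1 - 7 * s - 2 * s ^ 2`, hence negative. -/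
theorem polyG_eq_zero_iff {b s : ℝ} (hs : 1 / 4 < s) (hs1 : s < 1)
    (h : b * (4 * s ^ 3 + 2 * s ^ 2 - s + 1) = 1 - s) (r : ℝ) :
    polyG (3 * b) r = 0 ↔
      r = 9 * (s + 1) ^ 2 / (8 * (2 * s + 1) * (4 * s ^ 3 + 2 * s ^ 2 - s + 1)) := by
  have hD : 0 < 4 * s ^ 3 + 2 * s ^ 2 - s + 1 := by
    nlinarith [pow_pos (show 0 < s by linarith) 3, sq_nonneg s]
  obtain ⟨d, hd⟩ : ∃ d, d = 4 * s ^ 3 + 2 * s ^ 2 - s + 1 := ⟨_, rfl⟩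
  rw [← hd] at h hD ⊢
  have hb : b = (1 - s) / d := by field_simp; exact h
  set x := r * d with hx
  have key : polyG (3 * b) r * d ^ 4 =
      (8 * (2 * s + 1) * x - 9 * (s + 1) ^ 2) * (-768 * s ^ 2 * x ^ 2 +
        (768 * s ^ 5 + 384 * s ^ 4 - 2256 * s ^ 3 + 1176 * s ^ 2 - 96 * s + 24) * x -
        27 * (1 - s) ^ 2 * (4 * s ^ 2 - 2 * s + 1) ^ 2) := by
    rw [hb, polyG, hx]
    field_simp
    rw [hd]
    ring
  have hq : -768 * s ^ 2 * x ^ 2 +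
        (768 * s ^ 5 + 384 * s ^ 4 - 2256 * s ^ 3 + 1176 * s ^ 2 - 96 * s + 24) * x -
        27 * (1 - s) ^ 2 * (4 * s ^ 2 - 2 * s + 1) ^ 2 ≠ 0 := by
    intro hq
    have h1 : (1536 * s ^ 2 * x -
        (768 * s ^ 5 + 384 * s ^ 4 - 2256 * s ^ 3 + 1176 * s ^ 2 - 96 * s + 24)) ^ 2 =
        576 * ((1 - s) ^ 3 * (4 * s - 1) ^ 2) * ((1 + 10 * s + 32 * s ^ 2 + 32 * s ^ 3) *
          (1 - 7 * s - 2 * s ^ 2)) := by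
      linear_combination (-3072 * s ^ 2) * hq
    have h2 : 0 < (1 - s) ^ 3 * (4 * s - 1) ^ 2 :=
      mul_pos (pow_pos (by linarith) 3) (pow_pos (by linarith) 2)
    have h3 : 0 < 1 + 10 * s + 32 * s ^ 2 + 32 * s ^ 3 := by
      have : 0 < s := by linarith
      positivity
    have h4 : 1 - 7 * s - 2 * s ^ 2 < 0 := by nlinarith
    nlinarith [mul_pos h2 (mul_pos_of_neg_of_neg (neg_neg_of_pos h3) h4),
      sq_nonneg (1536 * s ^ 2 * x - (768 * s ^ 5 + 384 * s ^ 4 - 2256 * s ^ 3 + 1176 * s ^ 2 - 96 * s + 24))]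
  have hs2 : 2 * s + 1 ≠ 0 := by linarith
  rw [eq_div_iff (by positivity)]
  constructor
  · intro hr
    rw [hr, zero_mul] at key
    have := (mul_eq_zero.1 key.symm).resolve_right hq
    rw [hx] at this
    linear_combination this
  · intro hr
    have h0 : 8 * (2 * s + 1) * x - 9 * (s + 1) ^ 2 = 0 := by rw [hx]; linear_combination hr
    rw [h0, zero_mul] at key
    exact (mul_eq_zero.1 key).resolve_right (pow_ne_zero 4 hD.ne')

/-- In the variable `s = l k / (1 - k)` the cubic relation is linear in `1 - k`, which gives the
rational parametrisation. -/
theorem parameter_of_heightCubic {k l : ℝ} (hk1 : k < 1) (h : heightCubic k l = 0) :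
    (1 - k) * (4 * (l * k / (1 - k)) ^ 3 + 2 * (l * k / (1 - k)) ^ 2 -
      l * k / (1 - k) + 1) = 1 - l * k / (1 - k) := by
  have hb : 1 - k ≠ 0 := by linarith
  rw [heightCubic] at h
  field_simp
  linear_combination k * h

/-- For `l > 0` the cubic increases, and its value at `1` is `5 * k - 1 ≤ 0`. -/
theorem height_notMem_Ioo {k l : ℝ} (hk : 0 < k) (hk1 : k ≤ 1 / 5) (h : heightCubic k l = 0) :
    ¬ (0 < l ∧ l < 1) := by
  rintro ⟨h0, h1⟩
  have hb : 0 < 1 - k := by linarith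
  rw [heightCubic] at h
  have e1 : 0 < 1 - l ^ 3 := sub_pos.2 (pow_lt_one₀ h0.le h1 three_ne_zero)
  have e2 : 0 < 1 - l ^ 2 := sub_pos.2 (pow_lt_one₀ h0.le h1 two_ne_zero)
  have e3 : 0 < 1 - l := by linarith
  have p1 : 0 < 4 * k ^ 2 * (1 - l ^ 3) := by positivity
  have p2 : 0 < 2 * (1 - k) * k * (1 - l ^ 2) := by positivity
  have p3 : 0 < (1 - k) * k * (1 - l) := by positivity
  nlinarith

/-- The data of the interior common point. -/
theorem exists_interior_height {k : ℝ} (hk : 1 / 5 < k) (hk1 : k < 1) :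
    ∃ l ρ, 0 < l ∧ l < 1 ∧ (l ^ 2 * k + (1 - k)) ^ 2 = 4 * ρ * l ^ 2 * k ∧
      4 * ρ * (1 - k) = 4 * (l ^ 2 * k + (1 - k)) - 3 * (1 - k) * (k * (1 - l) ^ 2) ∧
      1 / (4 * k) < ρ ∧ (∀ r, polyG (3 * (1 - k)) r = 0 ↔ r = ρ) ∧
      ∀ l', heightCubic k l' = 0 → l' = l := by
  obtain ⟨s, hs, hs1, h⟩ := exists_parameter (b := 1 - k) (by linarith) (by linarith)
  have hD : 0 < 4 * s ^ 3 + 2 * s ^ 2 - s + 1 := by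
    nlinarith [pow_pos (show 0 < s by linarith) 3, sq_nonneg s]
  have hs0 : 0 < s := by linarith
  have hG := polyG_eq_zero_iff hs hs1 h
  obtain ⟨d, hd⟩ : ∃ d, d = 4 * s ^ 3 + 2 * s ^ 2 - s + 1 := ⟨_, rfl⟩
  have h' := h
  rw [← hd] at hD hG h'
  have hk' : k = 2 * s ^ 2 * (2 * s + 1) / d := by
    field_simp; linear_combination -h' + hd
  have hb' : 1 - k = (1 - s) / d := by field_simp; exact h'
  have hs2 : 0 < 2 * s + 1 := by linarith
  have h1s : 1 - s ≠ 0 := by linarith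
  refine ⟨(1 - s) / (2 * s * (2 * s + 1)), 9 * (s + 1) ^ 2 / (8 * (2 * s + 1) * d),
    ?_, ?_, ?_, ?_, ?_, hG, ?_⟩
  · exact div_pos (by linarith) (by positivity)
  · rw [div_lt_one (by positivity)]
    nlinarith
  · rw [hb', hk']; field_simp; ring
  · rw [hb', hk']; field_simp; rw [hd]; ring
  · have e : 1 / (4 * k) = d / (8 * s ^ 2 * (2 * s + 1)) := by rw [hk']; field_simp; ring
    rw [e, div_lt_div_iff₀ (by positivity) (by positivity)]
    -- This product equals `3 * s * (s + 1) - d`, and `ρ > R_T²` amounts to `d < 3 * s * (s + 1)`.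
    have h1 : 0 < (4 * s - 1) * (1 - s) * (1 + s) :=
      mul_pos (mul_pos (by linarith) (by linarith)) (by linarith)
    have h2 : d < 3 * s * (s + 1) := by rw [hd]; linarith
    have h3 : d ^ 2 < (3 * s * (s + 1)) ^ 2 := pow_lt_pow_left₀ h2 hD.le two_ne_zero
    have h4 := mul_lt_mul_of_pos_left h3 (show 0 < 8 * (2 * s + 1) by linarith)
    linarith
  · intro l' hl'
    have h1 := parameter_unique hs hs1 h (parameter_of_heightCubic hk1 hl')
    have hb : 1 - k ≠ 0 := by linarith
    have h2 : l' * k = s * (1 - k) := by field_simp at h1; linear_combination h1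
    have h3 : l' = s * (1 - k) / k := by field_simp; linear_combination h2
    rw [h3, hb', hk']
    field_simp

/-! ### The two ranges of the parameter. -/

theorem mainTheorem2 (T : Tetrahedron) (η : ℝ) (hT : IsTriangularPyramid T η) :
    (0 < η → η < 12 / 5 →
      ∃ (ρ X Y : ℝ) (O : E3),
        (∀ r, polyG η r = 0 ↔ r = ρ) ∧
        (∀ X' Y', PyramidSystem η X' Y' ρ ↔ X' = X ∧ Y' = Y) ∧
        (∀ P, HasDistCoords T ![X, Y, Y, Y] P ↔ P = O) ∧
        T.circumradius < Real.sqrt ρ ∧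
        rHulloid (Real.sqrt ρ) T.vertices = T.vertices ∪ {O} ∧
        O ∈ T.int) ∧
    (12 / 5 ≤ η → η < 3 →
      ∀ X Y ρ : ℝ, PyramidSystem η X Y ρ →
        ∃ O : E3,
          (∀ P, HasDistCoords T ![X, Y, Y, Y] P ↔ P = O) ∧
          IsGeometricallyAdmissible T ![X, Y, Y, Y] ρ O ∧
          (O ≠ T.points 0 → 0 < X ∧ 0 < Y) ∧
          ((O ∈ Metric.sphere T.circumcenter T.circumradius → O = T.points 0) →
            ∃ c : Fin 4 → E3, IsSupportingConfiguration T (Real.sqrt ρ) c ∧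
              Function.Injective c ∧ (⋂ j, Metric.sphere (c j) (Real.sqrt ρ)) = {O}) ∧
          O ∉ T.int ∧
          ∀ c : Fin 4 → E3, ¬ IsRBodyConfiguration T (Real.sqrt ρ) O c) := by
  obtain ⟨k, rfl⟩ : ∃ k, η = 3 * (1 - k) := ⟨1 - η / 3, by ring⟩
  constructor
  · intro h0 h1
    have hk : 1 / 5 < k := by linarith
    have hk0 : 0 < k := by linarith
    have hk1 : k < 1 := by linarith
    obtain ⟨l, ρ, hl0, hl1, e1, e2, hρ, hG, huniq⟩ := exists_interior_height hk hk1
    obtain ⟨hc, hO⟩ := heightCenters_spec hT hk0 hk1 e1 e2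
    have hR : T.circumradius < √ρ := by
      refine Real.lt_sqrt_of_sq_lt ?_
      rwa [(circumcenter_eq_and_circumradius_sq hT hk0.ne').2]
    have hint : T.pt ((1 - l) / 3) ((1 - l) / 3) ((1 - l) / 3) ∈ T.int :=
      (T.pt_diag_mem_int_iff _).2 ⟨by linarith, by linarith⟩
    refine ⟨ρ, k * (1 - l) ^ 2, l ^ 2 * k + (1 - k), _, hG, fun X' Y' => ?_,
      hasDistCoords_iff hT l, hR, hc.rHulloid_vertices_eq hO hint (Q := T.circumcenter) fun i => ?_,
      hint⟩
    · rw [pyramidSystem_iff hk0]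
      constructor
      · rintro ⟨l', hX, hY, h2, h3⟩
        rw [hX, hY] at h3
        rw [hY] at h2
        suffices l' = l by subst this; exact ⟨hX, hY⟩
        by_contra hne
        -- Any other height lies on the circumsphere and would force `ρ = R_T²`.
        have hanti : l' = 1 ∨ l' * k + (1 - k) = 0 := by
          rcases h3 with h3 | h3
          · exact Or.inl h3
          · exact Or.inr ((heightCubic_of_generic h2 h3).resolve_right fun h => hne (huniq l' h))
        exact hρ.ne' (radius_sq_of_antipodal hk0 hk1 h2 hanti)
      · rintro ⟨hX, hY⟩
        exact ⟨l, hX, hY, hY ▸ e1, Or.inr (hX ▸ hY ▸ e2)⟩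
    · rw [dist_comm, T.dist_circumcenter_eq_circumradius]
      exact hR
  · intro h0 h1 X Y ρ hS
    have hk : k ≤ 1 / 5 := by linarith
    have hk0 : 0 < k := by linarith
    have hk1 : k < 1 := by linarith
    obtain ⟨l, rfl, rfl, h2, h3⟩ := (pyramidSystem_iff hk0 X Y ρ).1 hS
    have hl := height_ne_zero hk1 h2
    have hY : 0 < l ^ 2 * k + (1 - k) := by nlinarith [mul_nonneg (sq_nonneg l) hk0.le]
    have hρ : 0 < ρ := by
      have : 0 < ρ * (4 * l ^ 2 * k) := by nlinarith [pow_pos hY 2]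
      exact (pos_iff_pos_of_mul_pos this).2 (by positivity)
    set O := T.pt ((1 - l) / 3) ((1 - l) / 3) ((1 - l) / 3) with hOdef
    have hcoord := hasDistCoords_iff hT l
    have hD : HasDistCoords T _ O := (hcoord O).2 rfl
    have hint : O ∉ T.int := by
      rw [hOdef, T.pt_diag_mem_int_iff]
      rintro ⟨ha, hb⟩
      rcases h3 with h3 | h3
      · linarith
      rcases heightCubic_of_generic h2 h3 with h4 | h4
      · nlinarith
      · exact height_notMem_Ioo hk0 hk h4 ⟨by linarith, by linarith⟩
    have hsph : (∃ c : Fin 4 → E3, IsSupportingConfiguration T √ρ c ∧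
        ∀ j, O ∈ Metric.sphere (c j) √ρ) ∧
        ((O ∈ Metric.sphere T.circumcenter T.circumradius → O = T.points 0) →
          ∃ c : Fin 4 → E3, IsSupportingConfiguration T √ρ c ∧
            Function.Injective c ∧ (⋂ j, Metric.sphere (c j) √ρ) = {O}) := by
      rcases h3 with h3 | h3
      · have hO0 : O = T.points 0 := by rw [hOdef, h3, ← T.pt_zero]; norm_num
        rw [radius_sq_of_antipodal hk0 hk1 h2 (Or.inl h3), hO0]
        obtain ⟨c, hc, hinj, hd, hi⟩ := exists_supporting_at_apex hT hk0 hk1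
        exact ⟨⟨c, hc, hd⟩, fun _ => ⟨c, hc, hinj, hi⟩⟩
      · obtain ⟨hc, hd⟩ := heightCenters_spec hT hk0 hk1 h2 h3
        refine ⟨⟨_, hc, hd⟩, fun hcirc => ⟨_, hc, heightCenters_inter hk0 hk1 hl ?_ hd⟩⟩
        -- Here `O` would be the antipode of the apex, where the spheres coincide; it lies on the
        -- circumsphere, so the hypothesis makes it the apex, which is absurd.
        intro ha
        have hle : l = -(1 - k) / k := by field_simp; linear_combination ha
        obtain ⟨hcc, hcr⟩ := circumcenter_eq_and_circumradius_sq hT hk0.ne'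
        have hO0 : O = T.points 0 := by
          refine hcirc ?_
          rw [Metric.mem_sphere, ← sq_eq_sq₀ dist_nonneg T.circumradius_nonneg, hcr, hcc, hOdef,
            dist_sq_pt hT, hle]
          field_simp
          ring
        rw [hOdef, ← T.pt_zero] at hO0
        have := (T.pt_inj hO0).1
        nlinarith
    refine ⟨O, hcoord, ⟨?_, hD, ?_, hρ, hsph.1⟩, fun hne => ⟨?_, hY⟩, hsph.2, hint,
      fun c hc => hint hc.mem_int⟩
    · obtain ⟨c, hc, hd⟩ := hsph.1
      exact tetrahedronSystem_of_spheres hρ.le hD hc hd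
    · intro i
      rw [← hD i]
      exact sq_nonneg _
    · have := hD 0
      rw [Matrix.cons_val_zero] at this
      rw [← this]
      exact pow_pos (dist_pos.2 hne) 2
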